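/- **Theorem.** Let $G=(V,E)$ be a finite simple graph with at least two vertices that is biconnected (connected and without a cutvertex) and 4-planar (planar with maximum degree at most $4$), and let $\mathrm{flex}\colon E\to\mathbb N_0\cup\{\infty\}$ be a flexibility function with $\mathrm{flex}(e)\ge 1$ for every edge $e$. An *orthogonal representation* $\mathcal R$ of $G$ consists of a planar embedding of $G$ (a rotation system of genus zero with a designated outer face), an integer rotation $\mathrm{rot}(e_f)$ for every incidence of an edge $e$ with a face $f$, and a rotation $\mathrm{rot}(v_f)$ for every angle at a vertex $v$ in a face $f$. The rotation of an edge is the number of its right bends minus the number of its left bends. The rotation of an angle is $1$, $0$ or $-1$ for a right turn ($90^\circ$), no turn ($180^\circ$) or a left turn ($270^\circ$), and $-2$ ($360^\circ$) at a vertex of degree one. Here inner faces are traversed clockwise and the outer face counterclockwise. The following is required: (I) the two rotations of each edge are negatives of each other; (II) the rotations of the edges and angles of a face sum to $4$ for each inner face and to $-4$ for the outer face; (III) the rotations of the angles around a vertex $v$ sum to $2(\deg(v)-2)$. The *number of bends* of $e$ is $|\mathrm{rot}(e_f)|$, and $\mathcal R$ is *valid* if every edge $e$ has at most $\mathrm{flex}(e)$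 bends. Let $\mathcal R$ be a valid orthogonal representation of $G$. Then $G$ has a valid orthogonal representation $\mathcal R'$ with the same planar embedding as $\mathcal R$ (including the outer face) and the same angles around vertices as $\mathcal R$, such that every edge has at most three bends in $\mathcal R'$, except for at most one edge, which lies on the outer face and has at most five bends. -/

import Mathlib

namespace OrthoDraw

variable {V : Type*}

/-- A graph is biconnected if it is connected and has no cutvertex, that is, no vertex whose removal
disconnects it. -/
def IsBiconnected (G : SimpleGraph V) : Prop :=
  G.Connected ∧ ∀ v : V, (G.induce ({v}ᶜ : Set V)).Preconnected

/-- A rotation system on `G`: for each vertex `v`, a cyclic order of the darts (oriented edges) that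
leave `v`. We read `next d` as the counterclockwise successor of `d` around its tail `d.fst`. -/
structure RotationSystem (G : SimpleGraph V) where
  next : Equiv.Perm G.Dart
  next_fst : ∀ d : G.Dart, (next d).fst = d.fst
  sameCycle_of_fst_eq : ∀ d d' : G.Dart, d.fst = d'.fst → next.SameCycle d d'

namespace RotationSystem

variable {G : SimpleGraph V} (S : RotationSystem G)

/-- The face traversal. Each dart `d` has one face on its right-hand side; `facePerm d` is the dart
that follows `d` when the boundary of that face is traversed with the face on the right. So inner
faces are traversed clockwise and the outer face is traversed counterclockwise. -/
def facePerm : Equiv.Perm G.Dart :=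
  (SimpleGraph.Dart.symm_involutive (G := G)).toPerm.trans S.next

theorem facePerm_apply (d : G.Dart) : S.facePerm d = S.next d.symm := rfl

theorem facePerm_fst (d : G.Dart) : (S.facePerm d).fst = d.snd := S.next_fst d.symm

/-- The faces are the orbits of the face traversal. -/
def Face : Type _ := Quotient (Equiv.Perm.SameCycle.setoid S.facePerm)

/-- The face on the right-hand side of the dart `d`. -/
def rightFace (d : G.Dart) : S.Face :=
  Quotient.mk (Equiv.Perm.SameCycle.setoid S.facePerm) d

end RotationSystem

/-- A planar embedding of a finite connected graph with at least one edge: a rotation system of genus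
zero (expressed by Euler's formula) with a designated outer face. -/
structure PlanarEmbedding (G : SimpleGraph V) extends RotationSystem G where
  connected : G.Connected
  euler : Nat.card V + Nat.card toRotationSystem.Face = Nat.card G.edgeSet + 2
  outer : toRotationSystem.Face

/-- A 4-planar graph: planar, with maximum degree at most four. -/
def IsFourPlanar (G : SimpleGraph V) [G.LocallyFinite] : Prop :=
  (∀ v : V, G.degree v ≤ 4) ∧ Nonempty (PlanarEmbedding G)

open Classical in
/-- An orthogonal representation of `G`: a planar embedding together with rotation values.

* `edgeRot d` is the rotation of the edge of `d` in the face `f` to the right of `d`: the number of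
  right bends minus the number of left bends when `d` is traversed, `f` being on the right.
* `vertexRot d` is the rotation of the tail `v = d.fst` in the angle of the face `f` to the right of
  `d` that lies just before `d` in the traversal of `f`, that is, in the angle at `v` between
  `next⁻¹ d` and `d`. It is `1` for a right turn (an angle of 90°), `0` for no turn (180°), `-1` for
  a left turn (270°), and `-2` at a vertex of degree one (360°). -/
structure OrthRep (G : SimpleGraph V) [Fintype V] extends PlanarEmbedding G where
  edgeRot : G.Dart → ℤ
  vertexRot : G.Dart → ℤ
  vertexRot_values : ∀ d : G.Dart,
    (G.degree d.fst ≠ 1 ∧ (vertexRot d = 1 ∨ vertexRot d = 0 ∨ vertexRot d = -1)) ∨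
      (G.degree d.fst = 1 ∧ vertexRot d = -2)
  edgeRot_symm : ∀ d : G.Dart, edgeRot d.symm = -edgeRot d
  face_sum : ∀ f : toRotationSystem.Face,
    ∑ d : G.Dart with toRotationSystem.rightFace d = f, (edgeRot d + vertexRot d) =
      if f = outer then -4 else 4
  vertex_sum : ∀ v : V, ∑ d : G.Dart with d.fst = v, vertexRot d = 2 * ((G.degree v : ℤ) - 2)

namespace OrthRep

theorem exists_dart {G : SimpleGraph V} (e : G.edgeSet) : ∃ d : G.Dart, d.edge = e.1 := by
  obtain ⟨e, he⟩ := e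
  induction e using Sym2.ind with
  | _ x y => exact ⟨⟨(x, y), he⟩, rfl⟩

variable {G : SimpleGraph V} [Fintype V] (R : OrthRep G)

/-- The number of bends of the edge `e`: the absolute value of its rotation, in either face. -/
noncomputable def bends (e : G.edgeSet) : ℕ := (R.edgeRot (exists_dart e).choose).natAbs

/-- The number of bends does not depend on the dart chosen for the edge. -/
theorem bends_eq (d : G.Dart) : R.bends ⟨d.edge, d.edge_mem⟩ = (R.edgeRot d).natAbs := by
  have h := (exists_dart (G := G) ⟨d.edge, d.edge_mem⟩).choose_spec
  rcases (SimpleGraph.dart_edge_eq_iff _ _).1 h with h | h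
  · rw [bends, h]
  · rw [bends, h, R.edgeRot_symm, Int.natAbs_neg]

/-- The orthogonal representation is valid for the flexibilities `flex` if each edge `e` has at most
`flex e` bends. -/
def IsValid (flex : G.edgeSet → ℕ∞) : Prop := ∀ e : G.edgeSet, (R.bends e : ℕ∞) ≤ flex e

/-- The edge `e` is incident to the outer face. -/
def OnOuterFace (e : G.edgeSet) : Prop :=
  ∃ d : G.Dart, d.edge = e.1 ∧ R.toRotationSystem.rightFace d = R.outer

end OrthRep

end OrthoDraw

/-! With the angles fixed, edge rotations form a flow in the dual graph: they are antisymmetric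
under reversing a dart, and their sum over each face is prescribed. So the task is to reroute this
flow under smaller capacities: `flex` truncated at 3, or at 5 for one edge of maximal flexibility
among those with the outer face on exactly one side. If rerouting fails, `exists_flow_or_cut` yields
a dual-connected face set `A`, left by an edge above its capacity, such that every edge leaving `A`
is at or above its capacity.

Such a cut is impossible (`OrthRep.not_cut`). Summing the face and vertex conditions over `A`
(`OrthRep.sum_boundaryDarts_le`) and using an Euler inequality for `A`
(`card_interiorVertices_add_card_le`) shows that the sum of `rot - 1` over the boundary darts is at
most 4, minus nonnegative losses at boundary vertices, minus 8 if `A` contains the outer face. No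
term is negative, because capacities are at least 1, and the overloaded edge has rotation at least 4
and contributes at least 3. The bound is then nearly tight, which by biconnectedness and Euler's
formula forces `A` to be the set of all inner faces (`OrthRep.eq_outer_of_notMem`). The boundary of
`A` now contains the exceptional edge: if it is the overloaded one it contributes at least 5,
otherwise both edges contribute at least 3. Either way the sum exceeds 4. -/

namespace OrthoDraw

/-! ### Rerouting flows in a capacitated network. -/

section Flow

open Classical in
/-- In a network whose arcs `d` lead from `r d` to `r (σ d)`, let `reach n a` say that `b` can be
reached from `a` along `n` usable arcs. A shortest path carries a unit flow. -/
theorem exists_unit_flow {D F : Type*} [Fintype D] {σ : D → D} (hσ : Function.Involutive σ)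
    (hfix : ∀ d, σ d ≠ d) (r : D → F) (ok : D → Prop) (b : F) (reach : ℕ → F → Prop)
    (h0 : ∀ a, reach 0 a ↔ a = b)
    (hs : ∀ n a, reach (n + 1) a ↔ ∃ d, ok d ∧ r d = a ∧ reach n (r (σ d))) (n : ℕ) :
    ∀ a, reach n a → (∀ m < n, ¬ reach m a) → ∃ y : D → ℤ, (∀ d, y (σ d) = -y d) ∧
      (∀ d, 0 < y d → y d = 1 ∧ ok d ∧ r d ≠ b) ∧
      (∀ d, y d ≠ 0 → ∃ m ≤ n, reach m (r d)) ∧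
      ∀ f, ∑ d with r d = f, y d = (if a = f then 1 else 0) - (if b = f then 1 else 0) := by
  induction n with
  | zero =>
    intro a ha _
    rw [h0] at ha
    subst ha
    exact ⟨0, by simp, by simp, by simp, by simp⟩
  | succ n ih =>
    intro a ha hmin
    obtain ⟨e, he, hea, hre⟩ := (hs n a).1 ha
    obtain ⟨y, hy, hpos, hsupp, hdiv⟩ := ih (r (σ e)) hre
      fun m hm hr => hmin (m + 1) (by omega) ((hs m a).2 ⟨e, he, hea, hr⟩)
    -- By minimality `a` has distance exactly `n + 1` from `b`, while `y` lives on arcs whose tails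
    -- are within distance `n`. So the new first arc is not used again.
    have hye : y e = 0 := by
      by_contra h
      obtain ⟨m, hm, hr⟩ := hsupp e h
      exact hmin m (by omega) (hea ▸ hr)
    have hyσ : y (σ e) = 0 := by rw [hy, hye, neg_zero]
    have hab : a ≠ b := fun h => hmin 0 (by omega) ((h0 a).2 h)
    refine ⟨fun d => y d + ((if e = d then 1 else 0) - (if σ e = d then 1 else 0)), ?_, ?_, ?_, ?_⟩
    · intro d
      have h1 : (e = σ d) = (σ e = d) := propext ⟨fun h => by rw [h, hσ], fun h => by rw [← h, hσ]⟩
      have h2 : (σ e = σ d) = (e = d) := propext hσ.injective.eq_iff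
      simp only [hy, h1, h2]
      ring
    · intro d hd
      by_cases h1 : e = d
      · subst h1
        simp only [hye, if_true, if_neg (hfix e)]
        exact ⟨by norm_num, he, hea ▸ hab⟩
      · by_cases h2 : σ e = d
        · subst h2
          simp [hyσ, (hfix e).symm] at hd
        · simp only [h1, h2, if_false, sub_zero, add_zero] at hd ⊢
          exact hpos d hd
    · intro d hd
      by_cases h1 : e = d
      · subst h1
        exact ⟨n + 1, le_rfl, hea.symm ▸ ha⟩
      · by_cases h2 : σ e = d
        · subst h2
          exact ⟨n, by omega, hre⟩
        · simp only [h1, h2, if_false, sub_zero, add_zero] at hd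
          obtain ⟨m, hm, hr⟩ := hsupp d hd
          exact ⟨m, by omega, hr⟩
    · intro f
      rw [Finset.sum_add_distrib, hdiv, Finset.sum_sub_distrib, Finset.sum_ite_eq,
        Finset.sum_ite_eq]
      simp only [Finset.mem_filter, Finset.mem_univ, true_and, hea]
      ring

open Classical in
/-- Capacity reduction in a network whose arcs `d` lead from `r d` to `r (σ d)`: a flow can be
rerouted, without raising any value above its capacity, until it respects all capacities, or some
connected set of nodes is a cut that certifies that this is impossible. -/
theorem exists_flow_or_cut {D F : Type*} [Fintype D] [Finite F] {σ : D → D}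
    (hσ : Function.Involutive σ) (hfix : ∀ d, σ d ≠ d) (r : D → F) (cap : D → ℕ)
    (hcap : ∀ d, cap (σ d) = cap d) (n : ℕ) :
    ∀ x₀ : D → ℤ, (∀ d, x₀ (σ d) = -x₀ d) → ∑ d, max (x₀ d).natAbs (cap d) = n →
    ∃ x : D → ℤ, (∀ d, x (σ d) = -x d) ∧
      (∀ f, ∑ d with r d = f, x d = ∑ d with r d = f, x₀ d) ∧
      (∀ d, (x d).natAbs ≤ max (x₀ d).natAbs (cap d)) ∧
      ((∀ d, (x d).natAbs ≤ cap d) ∨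
        ∃ (A : Finset F) (e : D), r e ∈ A ∧ r (σ e) ∉ A ∧ cap e < x e ∧
          (∀ d, r d ∈ A → r (σ d) ∉ A → cap d ≤ x d) ∧
          ∀ p : F → Prop, p (r e) →
            (∀ d, r d ∈ A → r (σ d) ∈ A → p (r d) → p (r (σ d))) → ∀ f ∈ A, p f) := by
  have := Fintype.ofFinite F
  induction n using Nat.strong_induction_on with
  | _ n ih =>
  intro x₀ hx₀ hn
  by_cases hall : ∀ d, (x₀ d).natAbs ≤ cap d
  · exact ⟨x₀, hx₀, fun _ => rfl, fun _ => le_max_left _ _, Or.inl hall⟩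
  obtain ⟨e, he⟩ : ∃ e, (cap e : ℤ) < x₀ e := by
    push Not at hall
    obtain ⟨d, hd⟩ := hall
    rcases le_total 0 (x₀ d) with h | h
    · exact ⟨d, by omega⟩
    · exact ⟨σ d, by rw [hx₀, hcap]; omega⟩
  let ok : D → Prop := fun d => x₀ d < cap d
  let step : F → F → Prop := fun a b => ∃ d, ok d ∧ r d = a ∧ r (σ d) = b
  by_cases hreach : Relation.ReflTransGen step (r e) (r (σ e))
  · let reach : ℕ → F → Prop := fun n => Nat.rec (fun a => a = r (σ e))
      (fun _ P a => ∃ d, ok d ∧ r d = a ∧ P (r (σ d))) n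
    have h0 : ∀ a, reach 0 a ↔ a = r (σ e) := fun a => Iff.rfl
    have hs : ∀ n a, reach (n + 1) a ↔ ∃ d, ok d ∧ r d = a ∧ reach n (r (σ d)) :=
      fun n a => Iff.rfl
    have hex : ∃ n, reach n (r e) := by
      generalize r e = a at hreach
      induction hreach using Relation.ReflTransGen.head_induction_on with
      | refl => exact ⟨0, rfl⟩
      | head h _ ih =>
        obtain ⟨d, hd, rfl, rfl⟩ := h
        obtain ⟨n, hn⟩ := ih
        exact ⟨n + 1, d, hd, rfl, hn⟩
    obtain ⟨k, hk, hmin⟩ : ∃ k, reach k (r e) ∧ ∀ m < k, ¬ reach m (r e) := by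
      have : DecidablePred fun k => reach k (r e) := Classical.decPred _
      exact ⟨Nat.find hex, Nat.find_spec hex, fun m hm => Nat.find_min hex hm⟩
    obtain ⟨y, hy, hpos, -, hdiv⟩ := exists_unit_flow hσ hfix r ok (r (σ e)) reach h0 hs k (r e)
      hk hmin
    -- The path avoids `e`, which is overloaded and hence not usable, and also `σ e`, which leaves
    -- the endpoint of the path.
    have hye : y e = 0 := by
      apply le_antisymm
      · by_contra h
        have := (hpos e (by omega)).2.1
        simp only [ok] at this
        omega
      · by_contra h
        exact (hpos (σ e) (by rw [hy]; omega)).2.2 rfl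
    have hyσ : y (σ e) = 0 := by rw [hy, hye, neg_zero]
    -- One unit is moved from `e` to the path. The endpoints agree, so divergences stay the same.
    let z : D → ℤ := fun d => x₀ d + y d - ((if e = d then 1 else 0) - (if σ e = d then 1 else 0))
    have hz : ∀ d, z (σ d) = -z d := by
      intro d
      have h1 : (e = σ d) = (σ e = d) := propext ⟨fun h => by rw [h, hσ], fun h => by rw [← h, hσ]⟩
      have h2 : (σ e = σ d) = (e = d) := propext hσ.injective.eq_iff
      simp only [z, hy, hx₀, h1, h2]
      ring
    have hze : z e = x₀ e - 1 := by simp [z, hye, hfix e]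
    have hzdiv : ∀ f, ∑ d with r d = f, z d = ∑ d with r d = f, x₀ d := by
      intro f
      simp only [z]
      rw [Finset.sum_sub_distrib, Finset.sum_add_distrib, hdiv, Finset.sum_sub_distrib,
        Finset.sum_ite_eq, Finset.sum_ite_eq]
      simp only [Finset.mem_filter, Finset.mem_univ, true_and]
      ring
    have hzle : ∀ d, max (z d).natAbs (cap d) ≤ max (x₀ d).natAbs (cap d) := by
      intro d
      by_cases h1 : e = d
      · subst h1
        rw [hze]
        omega
      by_cases h2 : σ e = d
      · subst h2
        rw [hz, hze, hx₀, hcap]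
        omega
      have hzd : z d = x₀ d + y d := by simp [z, h1, h2]
      rw [hzd]
      rcases lt_trichotomy (y d) 0 with h | h | h
      · have := hpos (σ d) (by rw [hy]; omega)
        simp only [ok, hy, hx₀, hcap] at this
        omega
      · rw [h, add_zero]
      · have := hpos d h
        simp only [ok] at this
        omega
    have hlt : ∑ d, max (z d).natAbs (cap d) < n := by
      rw [← hn]
      refine Finset.sum_lt_sum (fun d _ => hzle d) ⟨e, Finset.mem_univ e, ?_⟩
      rw [hze]
      omega
    obtain ⟨x, hx, hxdiv, hxle, hx'⟩ := ih _ hlt z hz rfl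
    refine ⟨x, hx, fun f => (hxdiv f).trans (hzdiv f), fun d => (hxle d).trans (hzle d), hx'⟩
  -- The cut is the set of nodes reachable from the tail of `e`: no usable arc leaves it, and it is
  -- connected by construction.
  · refine ⟨x₀, hx₀, fun _ => rfl, fun _ => le_max_left _ _, Or.inr
      ⟨Finset.univ.filter fun f => Relation.ReflTransGen step (r e) f, e, ?_, ?_, he, ?_, ?_⟩⟩
    · simp [Relation.ReflTransGen.refl]
    · simpa using hreach
    · intro d h1 h2
      simp only [Finset.mem_filter, Finset.mem_univ, true_and] at h1 h2
      by_contra h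
      exact h2 (h1.tail ⟨d, not_le.1 h, rfl, rfl⟩)
    · intro p hp hstep f hf
      simp only [Finset.mem_filter, Finset.mem_univ, true_and] at hf hstep
      induction hf with
      | refl => exact hp
      | tail h1 h2 ih =>
        obtain ⟨d, hd, rfl, rfl⟩ := h2
        exact hstep d h1 (h1.tail ⟨d, hd, rfl, rfl⟩) ih

end Flow

/-! ### An Euler inequality for connected sets of faces. -/

section Region

variable {V : Type*} {G : SimpleGraph V} (S : RotationSystem G)

theorem RotationSystem.rightFace_symm (d : G.Dart) :
    S.rightFace d.symm = S.rightFace (S.next d) := by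
  refine Quotient.sound ?_
  refine ⟨1, ?_⟩
  rw [zpow_one, S.facePerm_apply, d.symm_symm]

theorem RotationSystem.rightFace_facePerm (d : G.Dart) :
    S.rightFace (S.facePerm d) = S.rightFace d := by
  refine Quotient.sound ?_
  exact ⟨-1, by simp⟩

theorem eq_of_forall_dart {α : Type*} (hG : G.Connected) (c : V → α)
    (h : ∀ d : G.Dart, c d.fst = c d.snd) (u v : V) : c u = c v := by
  obtain ⟨w⟩ := hG.preconnected u v
  induction w with
  | nil => rfl
  | cons hadj _ ih => exact (h ⟨(_, _), hadj⟩).trans ih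

open Classical in
/-- The darts in a set closed under reversal are twice as many as those of them that are positive
for an orientation. -/
theorem card_eq_two_mul_card_filter {D : Type*} {σ : D → D} (hσ : Function.Involutive σ)
    (s : Finset D) (hs : ∀ d ∈ s, σ d ∈ s) (pos : D → Prop) (hpos : ∀ d, pos (σ d) ↔ ¬ pos d) :
    s.card = 2 * (s.filter pos).card := by
  rw [← Finset.card_filter_add_card_filter_not (s := s) pos, two_mul]
  congr 1
  refine (Finset.card_bij (fun d _ => σ d) ?_ (fun _ _ _ _ h => hσ.injective h) ?_).symm
  · intro d hd
    rw [Finset.mem_filter] at hd ⊢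
    exact ⟨hs d hd.1, by rw [hpos]; exact fun h => h hd.2⟩
  · intro d hd
    rw [Finset.mem_filter] at hd
    exact ⟨σ d, Finset.mem_filter.2 ⟨hs d hd.1, (hpos d).2 hd.2⟩, hσ d⟩

/-- Potential differences along edges are orthogonal to potential differences across edges. -/
theorem sum_vertex_mul_face_eq_zero [Fintype G.Dart] (c : V → ℚ) (h : S.Face → ℚ) :
    ∑ d : G.Dart, (c d.fst - c d.snd) * (h (S.rightFace d) - h (S.rightFace d.symm)) = 0 := by
  have h1 : ∑ d : G.Dart, c d.snd * (h (S.rightFace d) - h (S.rightFace d.symm)) =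
      ∑ d : G.Dart, c d.fst * (h (S.rightFace d.symm) - h (S.rightFace d)) := by
    refine Fintype.sum_equiv (SimpleGraph.Dart.symm_involutive.toPerm) _ _ fun d => ?_
    simp
  -- Around a fixed tail, the left face of `d` is the right face of `next d`.
  have h2 : ∑ d : G.Dart, c d.fst * h (S.rightFace d.symm) =
      ∑ d : G.Dart, c d.fst * h (S.rightFace d) := by
    refine Fintype.sum_equiv S.next _ _ fun d => ?_
    rw [S.next_fst, S.rightFace_symm]
  simp only [sub_mul, Finset.sum_sub_distrib, h1]
  simp only [mul_sub, Finset.sum_sub_distrib, h2]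
  ring

variable [Fintype V]

open Classical in
instance RotationSystem.finite_face : Finite S.Face :=
  Finite.of_surjective S.rightFace Quotient.mk_surjective

open Classical in
/-- The vertices all of whose angles lie in faces of `A`. -/
noncomputable def interiorVertices (A : Finset S.Face) : Finset V :=
  Finset.univ.filter fun v => ∀ d : G.Dart, d.fst = v → S.rightFace d ∈ A

open Classical in
/-- The darts with a face of `A` on both sides. -/
noncomputable def interiorDarts (A : Finset S.Face) : Finset G.Dart :=
  Finset.univ.filter fun d => S.rightFace d ∈ A ∧ S.rightFace d.symm ∈ A

open Classical in
/-- The darts with a face of `A` only on the right. -/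
noncomputable def boundaryDarts (A : Finset S.Face) : Finset G.Dart :=
  Finset.univ.filter fun d => S.rightFace d ∈ A ∧ S.rightFace d.symm ∉ A

open Classical in
/-- A connected region of faces that does not consist of all faces has Euler characteristic at
most one. -/
theorem card_interiorVertices_add_card_le (hG : G.Connected) (A : Finset S.Face) (e : G.Dart)
    (he : S.rightFace e ∈ A) (he' : S.rightFace e.symm ∉ A)
    (hA : ∀ p : S.Face → Prop, p (S.rightFace e) →
      (∀ d : G.Dart, S.rightFace d ∈ A → S.rightFace d.symm ∈ A →
        p (S.rightFace d) → p (S.rightFace d.symm)) → ∀ f ∈ A, p f) :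
    2 * ((interiorVertices S A).card + A.card) ≤ (interiorDarts S A).card + 2 := by
  let ι := Fintype.equivFin V
  let pos : G.Dart → Prop := fun d => ι d.fst < ι d.snd
  have hpos : ∀ d : G.Dart, pos d.symm ↔ ¬ pos d := by
    intro d
    have : ι d.fst ≠ ι d.snd := ι.injective.ne d.fst_ne_snd
    simp only [pos, not_lt]
    exact ⟨fun h => le_of_lt h, fun h => lt_of_le_of_ne h this.symm⟩
  let I := interiorVertices S A
  -- One face is dropped as a base point, so that constant functions on `A` do not spoil
  -- injectivity.
  let B := A.erase (S.rightFace e)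
  let O := (interiorDarts S A).filter pos
  have hcard : (interiorDarts S A).card = 2 * O.card := by
    convert card_eq_two_mul_card_filter SimpleGraph.Dart.symm_involutive (interiorDarts S A)
      ?_ pos hpos
    simp only [interiorDarts, Finset.mem_filter, Finset.mem_univ, true_and,
      SimpleGraph.Dart.symm_symm]
    exact fun d hd => hd.symm
  let extV : (I → ℚ) →ₗ[ℚ] (V → ℚ) := Function.ExtendByZero.linearMap ℚ Subtype.val
  let extF : (B → ℚ) →ₗ[ℚ] (S.Face → ℚ) := Function.ExtendByZero.linearMap ℚ Subtype.val
  -- Vertex potentials and face potentials, extended by zero, both give functions on the interior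
  -- edges. Injectivity of the sum of these two maps gives the inequality by comparing dimensions.
  let Θ : ((I → ℚ) × (B → ℚ)) →ₗ[ℚ] (O → ℚ) :=
    { toFun := fun p d => (extV p.1 d.1.fst - extV p.1 d.1.snd) +
        (extF p.2 (S.rightFace d.1) - extF p.2 (S.rightFace d.1.symm))
      map_add' := fun p q => funext fun d => by
        simp only [Prod.fst_add, Prod.snd_add, map_add, Pi.add_apply]
        ring
      map_smul' := fun a p => funext fun d => by
        simp only [Prod.smul_fst, Prod.smul_snd, map_smul, Pi.smul_apply, RingHom.id_apply,
          smul_eq_mul]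
        ring }
  have hinj : Function.Injective Θ := by
    rw [← LinearMap.ker_eq_bot, LinearMap.ker_eq_bot']
    rintro ⟨c, h⟩ hker
    let c' := extV c
    let h' := extF h
    have hker' : ∀ d ∈ O, (c' d.fst - c' d.snd) +
        (h' (S.rightFace d) - h' (S.rightFace d.symm)) = 0 := fun d hd => congrFun hker ⟨d, hd⟩
    have hint : ∀ d ∈ interiorDarts S A, (c' d.fst - c' d.snd) +
        (h' (S.rightFace d) - h' (S.rightFace d.symm)) = 0 := by
      intro d hd
      by_cases hp : pos d
      · exact hker' d (Finset.mem_filter.2 ⟨hd, hp⟩)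
      · have hd' : d.symm ∈ interiorDarts S A := by
          simp only [interiorDarts, Finset.mem_filter, Finset.mem_univ, true_and,
            SimpleGraph.Dart.symm_symm] at hd ⊢
          exact hd.symm
        have := hker' d.symm (Finset.mem_filter.2 ⟨hd', (hpos d).2 hp⟩)
        simp only [SimpleGraph.Dart.symm_symm] at this
        change (c' d.snd - c' d.fst) + _ = 0 at this
        linarith
    have hc0 : ∀ v, v ∉ I → c' v = 0 := by
      intro v hv
      exact Function.extend_apply' _ _ _ (by rintro ⟨a, rfl⟩; exact hv a.2)
    have hh0 : ∀ f, f ∉ B → h' f = 0 := by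
      intro f hf
      exact Function.extend_apply' _ _ _ (by rintro ⟨a, rfl⟩; exact hf a.2)
    have hfst : ∀ d : G.Dart, d ∉ interiorDarts S A → d.fst ∉ I := by
      intro d hd hI
      simp only [I, interiorVertices, interiorDarts, Finset.mem_filter, Finset.mem_univ,
        true_and] at hd hI
      exact hd ⟨hI d rfl, by rw [S.rightFace_symm]; exact hI _ (S.next_fst d)⟩
    have hext : ∀ d : G.Dart, d ∉ interiorDarts S A → c' d.fst - c' d.snd = 0 := by
      intro d hd
      have hd' : d.symm ∉ interiorDarts S A := by
        simp only [interiorDarts, Finset.mem_filter, Finset.mem_univ, true_and,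
          SimpleGraph.Dart.symm_symm] at hd ⊢
        exact fun h => hd h.symm
      rw [hc0 _ (hfst d hd), hc0 d.snd (hfst d.symm hd'), sub_zero]
    -- On the kernel the two differences are opposite on interior darts, and the vertex difference
    -- vanishes elsewhere. Orthogonality thus makes the sum of squares zero.
    have hsq : ∑ d : G.Dart, (c' d.fst - c' d.snd) ^ 2 = 0 := by
      rw [← neg_eq_zero, ← Finset.sum_neg_distrib, ← sum_vertex_mul_face_eq_zero S c' h']
      refine Finset.sum_congr rfl fun d _ => ?_
      by_cases hd : d ∈ interiorDarts S A
      · have : h' (S.rightFace d) - h' (S.rightFace d.symm) = -(c' d.fst - c' d.snd) := by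
          linarith [hint d hd]
        rw [this]
        ring
      · rw [hext d hd]
        ring
    have hz : ∀ d : G.Dart, c' d.fst - c' d.snd = 0 := by
      intro d
      have := (Finset.sum_eq_zero_iff_of_nonneg fun d _ => sq_nonneg _).1 hsq d (Finset.mem_univ d)
      exact pow_eq_zero_iff two_ne_zero |>.1 this
    have hc' : ∀ v, c' v = 0 := by
      intro v
      rw [eq_of_forall_dart hG c' (fun d => sub_eq_zero.1 (hz d)) v e.fst]
      refine hc0 _ (hfst e ?_)
      simp [interiorDarts, he']
    have hh' : ∀ f ∈ A, h' f = 0 := by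
      refine hA (fun f => h' f = 0) (hh0 _ (Finset.notMem_erase _ _)) fun d h1 h2 h3 => ?_
      have := hint d (by simp [interiorDarts, h1, h2])
      rw [hz d, h3] at this
      linarith
    refine Prod.ext (funext fun v => ?_) (funext fun f => ?_)
    · have := hc' v
      rwa [show c' v = c v from Subtype.val_injective.extend_apply _ _ _] at this
    · have := hh' f (Finset.mem_of_mem_erase f.2)
      rwa [show h' f = h f from Subtype.val_injective.extend_apply _ _ _] at this
  have hrank := LinearMap.finrank_le_finrank_of_injective hinj
  rw [Module.finrank_prod, Module.finrank_fintype_fun_eq_card,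
    Module.finrank_fintype_fun_eq_card, Module.finrank_fintype_fun_eq_card, Fintype.card_coe,
    Fintype.card_coe, Fintype.card_coe, Finset.card_erase_of_mem he] at hrank
  have : 0 < A.card := Finset.card_pos.2 ⟨_, he⟩
  simp only [I] at hrank
  omega

end Region

/-! ### The total rotation around a set of faces. -/

section Rotation

variable {V : Type*} [Fintype V] {G : SimpleGraph V}

open Classical in
/-- The angles at `v` that do not lie in faces of `A`. -/
noncomputable def exteriorAngles (S : RotationSystem G) (A : Finset S.Face) (v : V) :
    Finset G.Dart :=
  Finset.univ.filter fun d => d.fst = v ∧ S.rightFace d ∉ A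

open Classical in
/-- The boundary darts of `A` that leave `v`. -/
noncomputable def boundaryDartsAt (S : RotationSystem G) (A : Finset S.Face) (v : V) :
    Finset G.Dart :=
  (boundaryDarts S A).filter fun d => d.fst = v

/-- The vertices with angles both inside and outside of `A`. -/
def IsBoundaryVertex (S : RotationSystem G) (A : Finset S.Face) (v : V) : Prop :=
  (∃ d : G.Dart, d.fst = v ∧ S.rightFace d ∈ A) ∧ ∃ d : G.Dart, d.fst = v ∧ S.rightFace d ∉ A

open Classical in
/-- A lower bound for the loss that the vertex `v` causes in the rotation around `A`. -/
noncomputable def rotationLoss (S : RotationSystem G) (A : Finset S.Face) (v : V) : ℤ :=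
  if IsBoundaryVertex S A v then
    (exteriorAngles S A v).card + 3 * (boundaryDartsAt S A v).card - 4 else 0

section System

variable (S : RotationSystem G) (A : Finset S.Face)

theorem mem_interiorDarts {d : G.Dart} :
    d ∈ interiorDarts S A ↔ S.rightFace d ∈ A ∧ S.rightFace d.symm ∈ A := by
  simp [interiorDarts]

theorem mem_boundaryDarts {d : G.Dart} :
    d ∈ boundaryDarts S A ↔ S.rightFace d ∈ A ∧ S.rightFace d.symm ∉ A := by
  simp [boundaryDarts]

theorem mem_interiorVertices {v : V} :
    v ∈ interiorVertices S A ↔ ∀ d : G.Dart, d.fst = v → S.rightFace d ∈ A := by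
  simp [interiorVertices]

theorem mem_exteriorAngles {v : V} {d : G.Dart} :
    d ∈ exteriorAngles S A v ↔ d.fst = v ∧ S.rightFace d ∉ A := by
  simp [exteriorAngles]

theorem mem_boundaryDartsAt {v : V} {d : G.Dart} :
    d ∈ boundaryDartsAt S A v ↔ d ∈ boundaryDarts S A ∧ d.fst = v := by
  simp [boundaryDartsAt]

theorem card_boundaryDartsAt_le (v : V) :
    (boundaryDartsAt S A v).card ≤ (exteriorAngles S A v).card := by
  refine Finset.card_le_card_of_injOn S.next (fun d hd => ?_) S.next.injective.injOn
  simp only [Finset.mem_coe, mem_boundaryDartsAt, mem_boundaryDarts, S.rightFace_symm] at hd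
  rw [Finset.mem_coe, mem_exteriorAngles, S.next_fst]
  exact ⟨hd.2, hd.1.2⟩

-- Turning around `v` from an angle in `A` to one outside, some step must leave `A`.
open Classical in
theorem card_boundaryDartsAt_pos {v : V} (hv : IsBoundaryVertex S A v) :
    0 < (boundaryDartsAt S A v).card := by
  obtain ⟨⟨d, rfl, hd⟩, d', hd', hdA'⟩ := hv
  rw [Finset.card_pos]
  by_contra hne
  rw [Finset.not_nonempty_iff_eq_empty] at hne
  obtain ⟨n, hn⟩ := (S.sameCycle_of_fst_eq d d' hd'.symm).exists_nat_pow_eq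
  have key : ∀ n : ℕ, ((S.next ^ n) d).fst = d.fst ∧ S.rightFace ((S.next ^ n) d) ∈ A := by
    intro n
    induction n with
    | zero => exact ⟨rfl, hd⟩
    | succ n ih =>
      rw [pow_succ', Equiv.Perm.mul_apply, S.next_fst]
      refine ⟨ih.1, ?_⟩
      by_contra h
      refine Finset.notMem_empty ((S.next ^ n) d) (hne ▸ ?_)
      rw [mem_boundaryDartsAt, mem_boundaryDarts, S.rightFace_symm]
      exact ⟨⟨ih.2, h⟩, ih.1⟩
  exact hdA' (hn ▸ (key n).2)

theorem boundaryDartsAt_eq_empty {v : V} (hv : ¬ IsBoundaryVertex S A v) :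
    boundaryDartsAt S A v = ∅ := by
  rw [Finset.eq_empty_iff_forall_notMem]
  intro d hd
  rw [mem_boundaryDartsAt, mem_boundaryDarts, S.rightFace_symm] at hd
  exact hv ⟨⟨d, hd.2, hd.1.1⟩, S.next d, (S.next_fst d).trans hd.2, hd.1.2⟩

theorem rotationLoss_nonneg (v : V) : 0 ≤ rotationLoss S A v := by
  unfold rotationLoss
  split_ifs with hv
  · have := card_boundaryDartsAt_le S A v
    have := card_boundaryDartsAt_pos S A hv
    omega
  · exact le_rfl

end System

variable (R : OrthRep G) (A : Finset R.Face)

theorem OrthRep.vertexRot_le_one (d : G.Dart) : R.vertexRot d ≤ 1 := by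
  rcases R.vertexRot_values d with ⟨-, h | h | h⟩ | ⟨-, h⟩ <;> omega

open Classical in
theorem OrthRep.vertex_sum_card (v : V) :
    ∑ d : G.Dart with d.fst = v, R.vertexRot d =
      2 * (((Finset.univ.filter fun d : G.Dart => d.fst = v).card : ℤ) - 2) := by
  rw [R.vertex_sum v, ← G.dart_fst_fiber_card_eq_degree v]

open Classical in
/-- The rotation at a vertex in the faces of `A`. -/
theorem OrthRep.le_sum_vertexRot_at (v : V) :
    2 * ((Finset.univ.filter fun d : G.Dart => d.fst = v ∧ R.rightFace d ∈ A).card : ℤ)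
        - 3 * (boundaryDartsAt R.toRotationSystem A v).card
        + rotationLoss R.toRotationSystem A v
        - (if v ∈ interiorVertices R.toRotationSystem A then 4 else 0) ≤
      ∑ d : G.Dart with d.fst = v ∧ R.rightFace d ∈ A, R.vertexRot d := by
  have hsplit := Finset.sum_filter_add_sum_filter_not
    (Finset.univ.filter fun d : G.Dart => d.fst = v) (fun d => R.rightFace d ∈ A) R.vertexRot
  have hcard := Finset.card_filter_add_card_filter_not
    (s := Finset.univ.filter fun d : G.Dart => d.fst = v) (fun d => R.rightFace d ∈ A)
  rw [Finset.filter_filter, Finset.filter_filter] at hsplit hcard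
  rw [R.vertex_sum_card] at hsplit
  change _ + (exteriorAngles R.toRotationSystem A v).card = _ at hcard
  change _ + ∑ d ∈ exteriorAngles R.toRotationSystem A v, _ = _ at hsplit
  have hle : ∑ d ∈ exteriorAngles R.toRotationSystem A v, R.vertexRot d ≤
      (exteriorAngles R.toRotationSystem A v).card := by
    simpa using Finset.sum_le_card_nsmul _ _ 1 fun d _ => R.vertexRot_le_one d
  -- Bounding each exterior angle by 1 in the vertex condition leaves at least `2 * inside + outside
  -- - 4`; the loss is defined so that this has the stated form.
  by_cases hbd : IsBoundaryVertex R.toRotationSystem A v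
  · have hint : v ∉ interiorVertices R.toRotationSystem A := by
      obtain ⟨-, d, hd, hdA⟩ := hbd
      rw [mem_interiorVertices]
      exact fun h => hdA (h d hd)
    rw [rotationLoss, if_pos hbd, if_neg hint]
    omega
  · rw [rotationLoss, if_neg hbd, boundaryDartsAt_eq_empty _ _ hbd, Finset.card_empty]
    by_cases hint : v ∈ interiorVertices R.toRotationSystem A
    · have : exteriorAngles R.toRotationSystem A v = ∅ := by
        rw [Finset.eq_empty_iff_forall_notMem]
        intro d hd
        rw [mem_exteriorAngles] at hd
        exact hd.2 ((mem_interiorVertices _ _).1 hint d hd.1)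
      rw [this] at hsplit hcard
      rw [if_pos hint]
      simp only [Finset.sum_empty, Finset.card_empty] at hsplit hcard
      omega
    · have : (Finset.univ.filter fun d : G.Dart => d.fst = v ∧ R.rightFace d ∈ A) = ∅ := by
        rw [Finset.eq_empty_iff_forall_notMem]
        intro d hd
        rw [Finset.mem_filter] at hd
        rw [mem_interiorVertices] at hint
        push Not at hint
        exact hbd ⟨⟨d, hd.2⟩, hint⟩
      rw [this, if_neg hint]
      simp

open Classical in
theorem card_filter_rightFace_mem (S : RotationSystem G) (A : Finset S.Face) :
    (Finset.univ.filter fun d : G.Dart => S.rightFace d ∈ A).card =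
      (interiorDarts S A).card + (boundaryDarts S A).card := by
  rw [← Finset.card_filter_add_card_filter_not (fun d : G.Dart => S.rightFace d.symm ∈ A),
    Finset.filter_filter, Finset.filter_filter]
  rfl

open Classical in
theorem card_boundaryDarts_eq_sum (S : RotationSystem G) (A : Finset S.Face) :
    (boundaryDarts S A).card = ∑ v, (boundaryDartsAt S A v).card :=
  Finset.card_eq_sum_card_fiberwise fun _ _ => Finset.mem_coe.2 (Finset.mem_univ _)

open Classical in
theorem OrthRep.le_sum_vertexRot :
    2 * ((interiorDarts R.toRotationSystem A).card : ℤ)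
        - (boundaryDarts R.toRotationSystem A).card
        + ∑ v, rotationLoss R.toRotationSystem A v
        - 4 * (interiorVertices R.toRotationSystem A).card ≤
      ∑ d : G.Dart with R.rightFace d ∈ A, R.vertexRot d := by
  have h := Finset.sum_le_sum fun v (_ : v ∈ Finset.univ) => R.le_sum_vertexRot_at A v
  have h1 : ∑ v, ∑ d : G.Dart with d.fst = v ∧ R.rightFace d ∈ A, R.vertexRot d =
      ∑ d : G.Dart with R.rightFace d ∈ A, R.vertexRot d := by
    rw [← Finset.sum_fiberwise _ (fun d : G.Dart => d.fst)]
    simp only [Finset.filter_filter, and_comm]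
  have h2 : ∑ v, (Finset.univ.filter fun d : G.Dart => d.fst = v ∧ R.rightFace d ∈ A).card =
      (interiorDarts R.toRotationSystem A).card + (boundaryDarts R.toRotationSystem A).card := by
    rw [← card_filter_rightFace_mem, Finset.card_eq_sum_card_fiberwise
      (f := fun d : G.Dart => d.fst) (t := Finset.univ)
      fun _ _ => Finset.mem_coe.2 (Finset.mem_univ _)]
    simp only [Finset.filter_filter, and_comm]
  have h3 := card_boundaryDarts_eq_sum R.toRotationSystem A
  rw [h1, Finset.sum_sub_distrib, Finset.sum_add_distrib, Finset.sum_sub_distrib,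
    ← Finset.mul_sum, ← Finset.mul_sum, ← Nat.cast_sum, ← Nat.cast_sum, h2, ← h3,
    Finset.sum_ite_mem, Finset.univ_inter, Finset.sum_const, nsmul_eq_mul] at h
  push_cast at h
  linarith

-- The two darts of an edge with `A` on both sides cancel.
open Classical in
theorem OrthRep.sum_edgeRot :
    ∑ d : G.Dart with R.rightFace d ∈ A, R.edgeRot d =
      ∑ d ∈ boundaryDarts R.toRotationSystem A, R.edgeRot d := by
  rw [← Finset.sum_filter_add_sum_filter_not _ (fun d : G.Dart => R.rightFace d.symm ∈ A),
    Finset.filter_filter, Finset.filter_filter]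
  change ∑ d ∈ interiorDarts R.toRotationSystem A, R.edgeRot d +
    ∑ d ∈ boundaryDarts R.toRotationSystem A, R.edgeRot d = _
  have : ∑ d ∈ interiorDarts R.toRotationSystem A, R.edgeRot d =
      ∑ d ∈ interiorDarts R.toRotationSystem A, -R.edgeRot d := by
    refine Finset.sum_bij (fun d _ => d.symm) (fun d hd => ?_)
      (fun _ _ _ _ h => SimpleGraph.Dart.symm_involutive.injective h) (fun d hd => ?_)
      fun d _ => by rw [R.edgeRot_symm, neg_neg]
    · rw [mem_interiorDarts, SimpleGraph.Dart.symm_symm] at *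
      exact hd.symm
    · refine ⟨d.symm, ?_, d.symm_symm⟩
      rw [mem_interiorDarts, SimpleGraph.Dart.symm_symm] at *
      exact hd.symm
  rw [Finset.sum_neg_distrib] at this
  linarith

open Classical in
/-- The rotation of the edges around the faces of `A`. -/
theorem OrthRep.sum_boundaryDarts_le :
    ∑ d ∈ boundaryDarts R.toRotationSystem A, R.edgeRot d
        + ∑ v, rotationLoss R.toRotationSystem A v
        + 2 * (interiorDarts R.toRotationSystem A).card
        + (if R.outer ∈ A then 8 else 0) ≤
      4 * (A.card + (interiorVertices R.toRotationSystem A).card)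
        + (boundaryDarts R.toRotationSystem A).card := by
  have h := Finset.sum_congr rfl fun f (_ : f ∈ A) => R.face_sum f
  have h0 : ∑ f ∈ A, ∑ d : G.Dart with R.rightFace d = f, (R.edgeRot d + R.vertexRot d) =
      ∑ d : G.Dart with R.rightFace d ∈ A, (R.edgeRot d + R.vertexRot d) := by
    convert Finset.sum_fiberwise_eq_sum_filter Finset.univ A R.rightFace _
  rw [h0, Finset.sum_add_distrib, R.sum_edgeRot A] at h
  have h1 : ∑ f ∈ A, (if f = R.outer then (-4 : ℤ) else 4) =
      4 * A.card - (if R.outer ∈ A then 8 else 0) := by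
    have : ∀ f, (if f = R.outer then (-4 : ℤ) else 4) = 4 - (if R.outer = f then 8 else 0) := by
      intro f
      by_cases hf : f = R.outer
      · subst hf; simp
      · simp [hf, Ne.symm hf]
    simp only [this, Finset.sum_sub_distrib, Finset.sum_ite_eq, Finset.sum_const, nsmul_eq_mul]
    ring
  rw [h1] at h
  have := R.le_sum_vertexRot A
  linarith

end Rotation

/-! ### Recognizing the set of all inner faces. -/

section Outer

variable {V : Type*} [Fintype V] {G : SimpleGraph V}

section System

variable (S : RotationSystem G) (A : Finset S.Face)

/-- A vertex all of whose angles lie outside of `A`. -/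
def IsExteriorVertex (v : V) : Prop := ∀ d : G.Dart, d.fst = v → S.rightFace d ∉ A

open Classical in
theorem one_lt_card_exteriorAngles {v : V} (hv : IsBoundaryVertex S A v) {d : G.Dart}
    (hd : d.fst = v) (h1 : S.rightFace d ∉ A) (h2 : S.rightFace d.symm ∉ A) :
    1 < (exteriorAngles S A v).card := by
  rw [Finset.one_lt_card]
  refine ⟨d, (mem_exteriorAngles _ _).2 ⟨hd, h1⟩, S.next d,
    (mem_exteriorAngles _ _).2 ⟨(S.next_fst d).trans hd, S.rightFace_symm d ▸ h2⟩, fun h => ?_⟩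
  obtain ⟨⟨d', hd', hdA'⟩, -⟩ := hv
  obtain ⟨n, hn⟩ := S.sameCycle_of_fst_eq d d' (hd.trans hd'.symm)
  rw [Equiv.Perm.zpow_apply_eq_self_of_apply_eq_self h.symm] at hn
  exact h1 (hn ▸ hdA')

/-- In a biconnected graph, if all boundary vertices but `v₀` have one exterior angle and some vertex
other than `v₀` has an angle in `A`, then every vertex has an angle in `A`. -/
theorem not_isExteriorVertex (hbi : IsBiconnected G) (v₀ u : V) (hu : u ≠ v₀)
    (hv₀ : ¬ IsExteriorVertex S A v₀) (hu' : ¬ IsExteriorVertex S A u)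
    (h : ∀ v, v ≠ v₀ → IsBoundaryVertex S A v → (exteriorAngles S A v).card ≤ 1) (z : V) :
    ¬ IsExteriorVertex S A z := by
  intro hz
  have hzv : z ≠ v₀ := fun h => hv₀ (h ▸ hz)
  obtain ⟨w⟩ := hbi.2 v₀ ⟨z, hzv⟩ ⟨u, hu⟩
  have key : ∀ a b : ({v₀}ᶜ : Set V), (G.induce ({v₀}ᶜ : Set V)).Walk a b →
      IsExteriorVertex S A a.1 → IsExteriorVertex S A b.1 := by
    intro a b w
    induction w with
    | nil => exact id
    | @cons a c b hadj _ ih =>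
      intro ha
      -- Exteriority spreads along edges avoiding `v₀`: a neighbour with an angle in `A` would have
      -- an exterior angle on each side of the edge.
      refine ih ?_
      let d : G.Dart := ⟨(a.1, c.1), hadj⟩
      have h1 : S.rightFace d ∉ A := ha d rfl
      have h2 : S.rightFace d.symm ∉ A := by
        rw [S.rightFace_symm]
        exact ha _ (S.next_fst d)
      by_contra hc
      simp only [IsExteriorVertex] at hc
      push Not at hc
      have hb : IsBoundaryVertex S A c.1 := ⟨hc, d.symm, rfl, h2⟩
      have := one_lt_card_exteriorAngles S A hb (d := d.symm) rfl h2 (by rwa [d.symm_symm])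
      have := h c.1 c.2 hb
      omega
  exact hu' (key _ _ w hz)

open Classical in
/-- If all boundary vertices but `v₀` have one exterior angle, no edge has exterior faces on both
sides. -/
theorem mem_or_symm_mem (hbi : IsBiconnected G) (v₀ u : V) (hu : u ≠ v₀)
    (hv₀ : ¬ IsExteriorVertex S A v₀) (hu' : ¬ IsExteriorVertex S A u)
    (h : ∀ v, v ≠ v₀ → IsBoundaryVertex S A v → (exteriorAngles S A v).card ≤ 1) (d : G.Dart) :
    S.rightFace d ∈ A ∨ S.rightFace d.symm ∈ A := by
  by_contra hd
  rw [not_or] at hd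
  wlog hne : d.fst ≠ v₀ generalizing d
  · refine this d.symm ⟨hd.2, by rw [d.symm_symm]; exact hd.1⟩ fun h' => ?_
    rw [not_not] at hne
    exact d.fst_ne_snd (hne.trans h'.symm)
  have hext := not_isExteriorVertex S A hbi v₀ u hu hv₀ hu' h d.fst
  simp only [IsExteriorVertex] at hext
  push Not at hext
  have hb : IsBoundaryVertex S A d.fst := ⟨hext, d, rfl, hd.1⟩
  have := one_lt_card_exteriorAngles S A hb rfl hd.1 hd.2
  have := h d.fst hne hb
  omega

open Classical in
theorem card_symm_boundaryDarts :
    (Finset.univ.filter fun d : G.Dart => S.rightFace d ∉ A ∧ S.rightFace d.symm ∈ A).card =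
      (boundaryDarts S A).card := by
  refine Finset.card_bij (fun d _ => d.symm) (fun d hd => ?_)
    (fun _ _ _ _ h => SimpleGraph.Dart.symm_involutive.injective h) fun d hd => ?_
  · rw [Finset.mem_filter] at hd
    rw [mem_boundaryDarts, d.symm_symm]
    exact hd.2.symm
  · rw [mem_boundaryDarts] at hd
    refine ⟨d.symm, Finset.mem_filter.2 ⟨Finset.mem_univ _, ?_⟩, d.symm_symm⟩
    rw [d.symm_symm]
    exact hd.symm

open Classical in
theorem card_dart_eq (h : ∀ d : G.Dart, S.rightFace d ∈ A ∨ S.rightFace d.symm ∈ A) :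
    Fintype.card G.Dart = (interiorDarts S A).card + 2 * (boundaryDarts S A).card := by
  rw [two_mul, ← add_assoc, ← card_filter_rightFace_mem, ← card_symm_boundaryDarts,
    ← Finset.card_univ,
    ← Finset.card_filter_add_card_filter_not (fun d : G.Dart => S.rightFace d ∈ A)]
  congr 2
  ext d
  simp only [Finset.mem_filter, Finset.mem_univ, true_and]
  exact ⟨fun hd => ⟨hd, (h d).resolve_left hd⟩, fun hd => hd.1⟩

end System

open Classical in
theorem PlanarEmbedding.two_mul_card (P : PlanarEmbedding G) :
    2 * (Fintype.card V + Nat.card P.Face) = Fintype.card G.Dart + 4 := by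
  have h := P.euler
  rw [Nat.card_eq_fintype_card, Nat.card_eq_fintype_card (α := G.edgeSet)] at h
  have h2 := G.dart_card_eq_twice_card_edges
  rw [SimpleGraph.edgeFinset_card] at h2
  have h3 : Fintype.card G.Dart = 2 * Fintype.card G.edgeSet := by convert h2
  omega

open Classical in
/-- A connected region around which the edges have rotation at least the number of edges plus three
consists of all inner faces. -/
theorem OrthRep.eq_outer_of_notMem (R : OrthRep G) (hbi : IsBiconnected G) (A : Finset R.Face)
    (e : G.Dart) (he : R.rightFace e ∈ A) (he' : R.rightFace e.symm ∉ A)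
    (hA : ∀ p : R.Face → Prop, p (R.rightFace e) →
      (∀ d : G.Dart, R.rightFace d ∈ A → R.rightFace d.symm ∈ A →
        p (R.rightFace d) → p (R.rightFace d.symm)) → ∀ f ∈ A, p f)
    (hrot : ((boundaryDarts R.toRotationSystem A).card : ℤ) + 3 ≤
      ∑ d ∈ boundaryDarts R.toRotationSystem A, R.edgeRot d) :
    ∀ f, f ∉ A ↔ f = R.outer := by
  have hbound := R.sum_boundaryDarts_le A
  have hchi := card_interiorVertices_add_card_le R.toRotationSystem hbi.1 A e he he' hA
  have hnn := rotationLoss_nonneg R.toRotationSystem A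
  have hloss0 : 0 ≤ ∑ v, rotationLoss R.toRotationSystem A v := Finset.sum_nonneg fun v _ => hnn v
  -- `hbound` and `hchi` leave at most 4 for the excess of rotation over boundary darts, and `hrot`
  -- already takes 3. So there is no room for the 8, and the total loss is at most 1.
  have houter : R.outer ∉ A := by
    intro h
    rw [if_pos h] at hbound
    omega
  rw [if_neg houter] at hbound
  have hloss : ∑ v, rotationLoss R.toRotationSystem A v ≤ 1 := by omega
  -- A strict inequality in `hchi` would cost 2 by parity, but only 1 is left.
  have hchi' : 2 * ((interiorVertices R.toRotationSystem A).card + A.card) =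
      (interiorDarts R.toRotationSystem A).card + 2 := by omega
  have hpair : ∀ u v, u ≠ v → rotationLoss R.toRotationSystem A u +
      rotationLoss R.toRotationSystem A v ≤ 1 := by
    intro u v huv
    rw [← Finset.sum_pair (f := rotationLoss R.toRotationSystem A) huv]
    exact (Finset.sum_le_sum_of_subset_of_nonneg (Finset.subset_univ _)
      fun v _ _ => hnn v).trans hloss
  have hfst : IsBoundaryVertex R.toRotationSystem A e.fst :=
    ⟨⟨e, rfl, he⟩, R.next e, R.next_fst e, by rwa [← R.rightFace_symm]⟩
  have hsnd : IsBoundaryVertex R.toRotationSystem A e.snd :=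
    ⟨⟨R.facePerm e, R.facePerm_fst e, by rwa [R.rightFace_facePerm]⟩, e.symm, rfl, he'⟩
  have hnext : ∀ v, IsBoundaryVertex R.toRotationSystem A v →
      ¬ IsExteriorVertex R.toRotationSystem A v := by
    rintro v ⟨⟨d, hd, hdA⟩, -⟩ h
    exact h d hd hdA
  -- Two or more exterior angles at a boundary vertex cost a loss of at least `2 + 3 - 4 = 1`, so
  -- this can happen at one vertex only.
  have hone : ∃ v₀, IsBoundaryVertex R.toRotationSystem A v₀ ∧
      ∀ v, v ≠ v₀ → IsBoundaryVertex R.toRotationSystem A v →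
        (exteriorAngles R.toRotationSystem A v).card ≤ 1 := by
    by_contra hcon
    push Not at hcon
    obtain ⟨v, -, hv, hv1⟩ := hcon e.fst hfst
    obtain ⟨u, huv, hu, hu1⟩ := hcon v hv
    have := hpair u v huv
    have := card_boundaryDartsAt_pos R.toRotationSystem A hu
    have := card_boundaryDartsAt_pos R.toRotationSystem A hv
    simp only [rotationLoss, if_pos hu, if_pos hv] at *
    omega
  obtain ⟨v₀, hv₀, h1⟩ := hone
  obtain ⟨u, hu, hub⟩ : ∃ u, u ≠ v₀ ∧ IsBoundaryVertex R.toRotationSystem A u := by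
    by_cases h : e.fst = v₀
    · exact ⟨e.snd, fun h' => e.fst_ne_snd (h.trans h'.symm), hsnd⟩
    · exact ⟨e.fst, h, hfst⟩
  have hext := not_isExteriorVertex R.toRotationSystem A hbi v₀ u hu (hnext _ hv₀) (hnext _ hub) h1
  have hdart := card_dart_eq R.toRotationSystem A
    (mem_or_symm_mem R.toRotationSystem A hbi v₀ u hu (hnext _ hv₀) (hnext _ hub) h1)
  have heuler := R.toPlanarEmbedding.two_mul_card
  -- With loss at most 1, each boundary vertex has exactly one boundary dart.
  have hB : (boundaryDarts R.toRotationSystem A).card ≤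
      (Finset.univ.filter fun v => v ∉ interiorVertices R.toRotationSystem A).card := by
    rw [card_boundaryDarts_eq_sum, Finset.card_filter]
    refine Finset.sum_le_sum fun v _ => ?_
    by_cases hv : IsBoundaryVertex R.toRotationSystem A v
    · have h2 : rotationLoss R.toRotationSystem A v ≤ 1 :=
        (Finset.single_le_sum (fun v _ => hnn v) (Finset.mem_univ v)).trans hloss
      have h3 := card_boundaryDartsAt_le R.toRotationSystem A v
      rw [rotationLoss, if_pos hv] at h2
      have h4 : v ∉ interiorVertices R.toRotationSystem A := by
        obtain ⟨-, d, hd, hdA⟩ := hv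
        rw [mem_interiorVertices]
        exact fun h => hdA (h d hd)
      rw [if_pos h4]
      omega
    · rw [boundaryDartsAt_eq_empty _ _ hv]
      exact Nat.zero_le _
  have hV := Finset.card_filter_add_card_filter_not (s := Finset.univ)
    fun v => v ∈ interiorVertices R.toRotationSystem A
  rw [Finset.filter_univ_mem, Finset.card_univ] at hV
  have := Fintype.ofFinite R.Face
  have hF := Finset.card_add_card_compl A
  rw [← Nat.card_eq_fintype_card] at hF
  -- Euler's formula for the whole graph is compared with the equality `hchi'` for `A`; by `hB` at
  -- most one face is left over.
  have hcompl : Aᶜ.card ≤ 1 := by omega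
  intro f
  constructor
  · exact fun hf => Finset.card_le_one.1 hcompl f (Finset.mem_compl.2 hf) _
      (Finset.mem_compl.2 houter)
  · rintro rfl
    exact houter

end Outer

/-! ### Excluding cuts for the truncated capacities. -/

section Main

variable {V : Type*} [Fintype V] {G : SimpleGraph V}

open Classical in
/-- The orthogonal representation with new rotations of the edges that add up to the same values
around each face. -/
noncomputable def OrthRep.withEdgeRot (R : OrthRep G) (x : G.Dart → ℤ)
    (hx : ∀ d : G.Dart, x d.symm = -x d)
    (hsum : ∀ f, ∑ d : G.Dart with R.rightFace d = f, x d =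
      ∑ d : G.Dart with R.rightFace d = f, R.edgeRot d) : OrthRep G :=
  { R with
    edgeRot := x
    edgeRot_symm := hx
    face_sum := fun f => by
      rw [← R.face_sum f, Finset.sum_add_distrib, Finset.sum_add_distrib, hsum f] }

theorem OrthRep.exists_bends_eq (R : OrthRep G) (e : G.edgeSet) :
    ∃ d : G.Dart, e = ⟨d.edge, d.edge_mem⟩ ∧ R.bends e = (R.edgeRot d).natAbs := by
  obtain ⟨d, hd⟩ := OrthRep.exists_dart e
  obtain rfl : e = ⟨d.edge, d.edge_mem⟩ := Subtype.ext hd.symm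
  exact ⟨d, rfl, R.bends_eq d⟩

/-- An edge of maximal flexibility among those that have the face `f` on one side only. -/
theorem exists_maximal_flex (S : RotationSystem G) (f : S.Face) (flex : G.edgeSet → ℕ∞) :
    ∃ exc : G.edgeSet → Prop, (∀ e e', exc e → exc e' → e = e') ∧
      (∀ e, exc e → ∃ d : G.Dart, d.edge = e.1 ∧ S.rightFace d = f) ∧
      ∀ d : G.Dart, S.rightFace d ≠ f → S.rightFace d.symm = f →
        ∃ d₀ : G.Dart, S.rightFace d₀ ≠ f ∧ S.rightFace d₀.symm = f ∧
          exc ⟨d₀.edge, d₀.edge_mem⟩ ∧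
          flex ⟨d.edge, d.edge_mem⟩ ≤ flex ⟨d₀.edge, d₀.edge_mem⟩ := by
  classical
  rcases (Finset.univ.filter fun d : G.Dart =>
    S.rightFace d ≠ f ∧ S.rightFace d.symm = f).eq_empty_or_nonempty with h | h
  · refine ⟨fun _ => False, by simp, by simp, fun d h1 h2 => ?_⟩
    exact absurd (Finset.mem_filter.2 ⟨Finset.mem_univ d, h1, h2⟩) (h ▸ Finset.notMem_empty d)
  · obtain ⟨d₀, h₀, hmax⟩ := Finset.exists_max_image _
      (fun d : G.Dart => flex ⟨d.edge, d.edge_mem⟩) h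
    rw [Finset.mem_filter] at h₀
    refine ⟨fun e => e = ⟨d₀.edge, d₀.edge_mem⟩, fun e e' h h' => h.trans h'.symm, ?_, ?_⟩
    · rintro _ rfl
      exact ⟨d₀.symm, d₀.edge_symm, h₀.2.2⟩
    · intro d h1 h2
      exact ⟨d₀, h₀.2.1, h₀.2.2, rfl, hmax d (Finset.mem_filter.2 ⟨Finset.mem_univ d, h1, h2⟩)⟩

/-- The cut condition for the reduced capacities. -/
theorem OrthRep.not_cut (R : OrthRep G) (hbi : IsBiconnected G)
    (flex : G.edgeSet → ℕ∞) (exc : G.edgeSet → Prop)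
    (hexc : ∀ d : G.Dart, R.rightFace d ≠ R.outer → R.rightFace d.symm = R.outer →
        ∃ d₀ : G.Dart, R.rightFace d₀ ≠ R.outer ∧ R.rightFace d₀.symm = R.outer ∧
          exc ⟨d₀.edge, d₀.edge_mem⟩ ∧
          flex ⟨d.edge, d.edge_mem⟩ ≤ flex ⟨d₀.edge, d₀.edge_mem⟩)
    (cap : G.Dart → ℕ) (hone : ∀ d, 1 ≤ cap d)
    (hthree : ∀ (d : G.Dart) (n : ℕ), (n : ℕ∞) ≤ flex ⟨d.edge, d.edge_mem⟩ → n ≤ 3 → n ≤ cap d)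
    (hfive : ∀ (d : G.Dart) (n : ℕ), (n : ℕ∞) ≤ flex ⟨d.edge, d.edge_mem⟩ →
      exc ⟨d.edge, d.edge_mem⟩ → n ≤ 5 → n ≤ cap d)
    (hflex : ∀ d : G.Dart, ((R.edgeRot d).natAbs : ℕ∞) ≤ flex ⟨d.edge, d.edge_mem⟩)
    (A : Finset R.Face) (e : G.Dart) (he : R.rightFace e ∈ A) (he' : R.rightFace e.symm ∉ A)
    (hA : ∀ p : R.Face → Prop, p (R.rightFace e) →
      (∀ d : G.Dart, R.rightFace d ∈ A → R.rightFace d.symm ∈ A →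
        p (R.rightFace d) → p (R.rightFace d.symm)) → ∀ f ∈ A, p f)
    (hecap : cap e < R.edgeRot e)
    (hcut : ∀ d : G.Dart, R.rightFace d ∈ A → R.rightFace d.symm ∉ A → cap d ≤ R.edgeRot d) :
    False := by
  classical
  have hle : ∀ (d : G.Dart) (n : ℕ), (n : ℤ) ≤ R.edgeRot d →
      (n : ℕ∞) ≤ flex ⟨d.edge, d.edge_mem⟩ := fun d n hn =>
    le_trans (Nat.cast_le.2 (by omega)) (hflex d)
  have hmem : e ∈ boundaryDarts R.toRotationSystem A := (mem_boundaryDarts _ _).2 ⟨he, he'⟩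
  have hnn : ∀ d ∈ boundaryDarts R.toRotationSystem A, 0 ≤ R.edgeRot d - 1 := by
    intro d hd
    rw [mem_boundaryDarts] at hd
    have := hcut d hd.1 hd.2
    have := hone d
    omega
  have hsum : ∑ d ∈ boundaryDarts R.toRotationSystem A, (R.edgeRot d - 1) =
      ∑ d ∈ boundaryDarts R.toRotationSystem A, R.edgeRot d -
        (boundaryDarts R.toRotationSystem A).card := by
    rw [Finset.sum_sub_distrib, Finset.sum_const, nsmul_one]
  -- The rotation of `e` is within `flex` but above the capacity, so the truncation at 3 must be
  -- what is exceeded.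
  have he4 : 4 ≤ R.edgeRot e := by
    by_contra h
    have := hthree e (cap e + 1) (hle e _ (by push_cast; omega)) (by omega)
    omega
  have hsingle := Finset.single_le_sum hnn hmem
  have houter := R.eq_outer_of_notMem hbi A e he he' hA (by omega)
  have hbound := R.sum_boundaryDarts_le A
  have hchi := card_interiorVertices_add_card_le R.toRotationSystem hbi.1 A e he he' hA
  have hloss0 : 0 ≤ ∑ v, rotationLoss R.toRotationSystem A v :=
    Finset.sum_nonneg fun v _ => rotationLoss_nonneg R.toRotationSystem A v
  rw [if_neg ((houter _).2 rfl)] at hbound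
  have hne : ∀ f, f ≠ R.outer ↔ f ∈ A := fun f => by rw [Ne, ← houter, not_not]
  obtain ⟨d₀, h₁, h₂, h₃, h₄⟩ := hexc e ((hne _).2 he) ((houter _).1 he')
  by_cases h : e = d₀
  · subst h
    have h6 : 6 ≤ R.edgeRot e := by
      by_contra h
      have := hfive e (cap e + 1) (hle e _ (by push_cast; omega)) h₃ (by omega)
      omega
    omega
  · rw [hne] at h₁
    rw [← houter] at h₂
    -- Maximality gives `d₀` flexibility at least that of `e`, hence capacity at least 4, and the
    -- cut forces its rotation up to that.
    have h5 := hfive d₀ 4 ((hle e 4 he4).trans h₄) h₃ (by norm_num)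
    have h6 := hcut d₀ h₁ h₂
    have hpair : (R.edgeRot e - 1) + (R.edgeRot d₀ - 1) ≤
        ∑ d ∈ boundaryDarts R.toRotationSystem A, (R.edgeRot d - 1) := by
      rw [← Finset.sum_pair (f := fun d => R.edgeRot d - 1) h]
      refine Finset.sum_le_sum_of_subset_of_nonneg ?_ fun d hd _ => hnn d hd
      intro d hd
      rw [Finset.mem_insert, Finset.mem_singleton] at hd
      rcases hd with rfl | rfl
      · exact hmem
      · exact (mem_boundaryDarts _ _).2 ⟨h₁, h₂⟩
    omega

end Main

end OrthoDraw

theorem mainTheorem4 {V : Type*} [Fintype V] [Nontrivial V] (G : SimpleGraph V) [G.LocallyFinite]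
    (hbi : OrthoDraw.IsBiconnected G) (hG : OrthoDraw.IsFourPlanar G)
    (flex : G.edgeSet → ℕ∞) (hflex : ∀ e : G.edgeSet, 1 ≤ flex e)
    (R : OrthoDraw.OrthRep G) (hR : R.IsValid flex) :
    ∃ R' : OrthoDraw.OrthRep G,
      R'.IsValid flex ∧
      R'.toPlanarEmbedding = R.toPlanarEmbedding ∧
      R'.vertexRot = R.vertexRot ∧
      ((∀ e : G.edgeSet, R'.bends e ≤ 3) ∨
        ∃ e₀ : G.edgeSet, R'.OnOuterFace e₀ ∧ R'.bends e₀ ≤ 5 ∧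
          ∀ e : G.edgeSet, e ≠ e₀ → R'.bends e ≤ 3) := by
  classical
  obtain ⟨exc, huniq, hout, hmax⟩ :=
    OrthoDraw.exists_maximal_flex R.toRotationSystem R.outer flex
  -- The minimum is finite even if `flex e = ⊤`, so `toNat` loses nothing.
  let capE : G.edgeSet → ℕ := fun e => (min (flex e) ((if exc e then 5 else 3 : ℕ) : ℕ∞)).toNat
  have hcapE : ∀ e, (capE e : ℕ∞) = min (flex e) ((if exc e then 5 else 3 : ℕ) : ℕ∞) := fun e =>
    ENat.natCast_toNat (ne_top_of_le_ne_top (ENat.natCast_ne_top _) (min_le_right _ _))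
  have hle_cap : ∀ (e : G.edgeSet) (n : ℕ), (n : ℕ∞) ≤ flex e →
      n ≤ (if exc e then 5 else 3) → n ≤ capE e := by
    intro e n h1 h2
    rw [← Nat.cast_le (α := ℕ∞), hcapE]
    exact le_min h1 (Nat.cast_le.2 h2)
  have hcap_flex : ∀ e, (capE e : ℕ∞) ≤ flex e := fun e => hcapE e ▸ min_le_left _ _
  have hcap_le : ∀ e, capE e ≤ if exc e then 5 else 3 := by
    intro e
    rw [← Nat.cast_le (α := ℕ∞), hcapE]
    exact min_le_right _ _
  let cap : G.Dart → ℕ := fun d => capE ⟨d.edge, d.edge_mem⟩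
  have hcap : ∀ d : G.Dart, cap d.symm = cap d := fun d =>
    congrArg capE (Subtype.ext d.edge_symm)
  obtain ⟨x, hx, hdiv, hxle, hx'⟩ := OrthoDraw.exists_flow_or_cut
    SimpleGraph.Dart.symm_involutive (fun d => d.symm_ne) R.rightFace cap hcap _ R.edgeRot
    R.edgeRot_symm rfl
  let R' := R.withEdgeRot x hx hdiv
  have hxflex : ∀ d : G.Dart, ((x d).natAbs : ℕ∞) ≤ flex ⟨d.edge, d.edge_mem⟩ := by
    intro d
    refine (Nat.cast_le.2 (hxle d)).trans ?_
    rcases le_total (R.edgeRot d).natAbs (cap d) with h | h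
    · rw [max_eq_right h]
      exact hcap_flex _
    · rw [max_eq_left h, ← R.bends_eq]
      exact hR _
  have hle : ∀ d, (x d).natAbs ≤ cap d := by
    refine hx'.resolve_right ?_
    rintro ⟨A, e, he, he', hecap, hcut, hA⟩
    -- The cut concerns the rerouted flow `x`, so it is refuted in `R'` rather than in `R`.
    exact R'.not_cut hbi flex exc hmax cap
      (fun d => hle_cap _ 1 (by exact_mod_cast hflex _) (by split_ifs <;> norm_num))
      (fun d n h1 h2 => hle_cap _ n h1 (by split_ifs <;> omega))
      (fun d n h1 h2 h3 => hle_cap _ n h1 (by rw [if_pos h2]; exact h3))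
      hxflex A e he he' hA hecap hcut
  have hbends : ∀ e : G.edgeSet, R'.bends e ≤ if exc e then 5 else 3 := by
    intro e
    obtain ⟨d, rfl, hd⟩ := R'.exists_bends_eq e
    rw [hd]
    exact (hle d).trans (hcap_le _)
  refine ⟨R', ?_, rfl, rfl, ?_⟩
  · intro e
    obtain ⟨d, rfl, hd⟩ := R'.exists_bends_eq e
    rw [hd]
    exact hxflex d
  · by_cases h : ∃ e₀, exc e₀
    · obtain ⟨e₀, h₀⟩ := h
      refine Or.inr ⟨e₀, hout e₀ h₀, by simpa [h₀] using hbends e₀, fun e he => ?_⟩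
      have := hbends e
      rwa [if_neg fun h => he (huniq e e₀ h h₀)] at this
    · push Not at h
      exact Or.inl fun e => by simpa [h e] using hbends e
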